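/- Let $n\ge 2$ and let $\alpha=(\alpha_1,\dots,\alpha_n)$ with $\alpha_k\in(-\pi,\pi)\setminus\{0\}$ for every $k$. For $x,\xi\in\mathbb{R}^n$ put $$K_\alpha(x,\xi)=\prod_{k=1}^n C_{\alpha_k}\exp\Big(i\Big(\tfrac{x_k^2+\xi_k^2}{2}\cot\alpha_k-x_k\xi_k\csc\alpha_k\Big)\Big),\qquad C_{\alpha_k}=\sqrt{\frac{1-i\cot\alpha_k}{2\pi}}$$ (principal square root). The fractional Fourier transform is $\mathcal{F}_\alpha\varphi(\xi)=\int_{\mathbb{R}^n}\varphi(x)K_\alpha(x,\xi)\,dx$ for $\varphi\in\mathcal{S}(\mathbb{R}^n)$; it maps $\mathcal{S}(\mathbb{R}^n)$ continuously into itself and is defined on $\mathcal{S}'(\mathbb{R}^n)$ by $\langle\mathcal{F}_\alpha f,\varphi\rangle=\langle f,\mathcal{F}_\alpha\varphi\rangle$. For $\eta\in\mathcal{S}(\mathbb{R})$ and $g\in\mathcal{S}(\mathbb{R}^n)$ the directional short-time fractional Fourier transform is $$DS_\eta^\alpha g(u,b,a)=\int_{\mathbb{R}^n}g(x)\,\overline{\eta(u\cdot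 x-b)}\,K_\alpha(x,a)\,dx,\qquad (u,b,a)\in\mathbb{S}^{n-1}\times\mathbb{R}\times\mathbb{R}^n.$$ The product of a tempered distribution $f$ with $\overline{\psi}((\cdot)\cdot u-b)$, where $\psi\in\mathcal{S}(\mathbb{R})$, is the tempered distribution $\varphi\mapsto\langle f(x),\overline{\psi(x\cdot u-b)}\,\varphi(x)\rangle$. Write $(\eta,\psi)=\int_{\mathbb{R}}\eta(t)\overline{\psi(t)}\,dt$, and let $du$ be the normalized surface area measure on $\mathbb{S}^{n-1}$. **Desingularization formula.** Let $f\in\mathcal{S}'(\mathbb{R}^n)$, let $\psi\in\mathcal{S}(\mathbb{R})$ be a non-trivial window, i.e. $\psi\neq 0$, and let $\eta\in\mathcal{S}(\mathbb{R})$ be a synthesis window for $\psi$, i.e. $(\eta,\psi)\ne 0$. Then for every $\varphi\in\mathcal{S}(\mathbb{R}^n)$ the function $$(u,b)\mapsto \big\langle \mathcal{F}_\alpha\big(f(\cdot)\,\overline{\psi}((\cdot)\cdot u-b)\big)(a),\ \overline{DS_\eta^\alpha(\overline{\varphi})(u,b,a)}\big\rangle_a$$ is integrable on $\mathbb{S}^{n-1}\times\mathbb{R}$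 with respect to $du\,db$, and $$\langle f,\varphi\rangle=\frac{1}{(\eta,\psi)}\int_{\mathbb{S}^{n-1}}\int_{\mathbb{R}}\big\langle \mathcal{F}_\alpha\big(f(\cdot)\,\overline{\psi}((\cdot)\cdot u-b)\big)(a),\ \overline{DS_\eta^\alpha(\overline{\varphi})(u,b,a)}\big\rangle_a\,db\,du.$$ -/

import Mathlib

open MeasureTheory
open scoped SchwartzMap ComplexConjugate ContDiff FourierTransform

noncomputable section

namespace DSTFRFT

/-- Euclidean space `ℝⁿ`. -/
abbrev Rn (n : ℕ) : Type := EuclideanSpace ℝ (Fin n)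

/-- The unit sphere `𝕊ⁿ⁻¹ ⊂ ℝⁿ`. -/
abbrev Sn (n : ℕ) : Type := Metric.sphere (0 : Rn n) 1

/-- The normalized surface area measure on `𝕊ⁿ⁻¹`. -/
def sphereMeasure (n : ℕ) : Measure (Sn n) :=
  ((volume : Measure (Rn n)).toSphere Set.univ)⁻¹ • (volume : Measure (Rn n)).toSphere

/-- The `L²` inner product `(η, ψ) = ∫ η(t) conj(ψ(t)) dt`, conjugate linear in the second
entry. -/
def l2Inner (η ψ : 𝓢(ℝ, ℂ)) : ℂ := ∫ t : ℝ, η t * conj (ψ t)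

/-- The admissible orders `α ∈ ((-π, π) \ {0})ⁿ`. -/
def IsOrder {n : ℕ} (α : Fin n → ℝ) : Prop := ∀ k, α k ∈ Set.Ioo (-Real.pi) Real.pi ∧ α k ≠ 0

/-- The constant `C_α = √((1 - i cot α) / 2π)` (principal square root). -/
def frftConst (α : ℝ) : ℂ := Complex.sqrt ((1 - Complex.I * (Real.cot α : ℂ)) / (2 * Real.pi : ℂ))

/-- The one-dimensional fractional Fourier kernel of an order `α ∉ πℤ`:
`C_α exp(i ((x² + ξ²)/2 · cot α - x ξ csc α))`. -/
def frftKernelOne (α x ξ : ℝ) : ℂ :=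
  frftConst α *
    Complex.exp (Complex.I *
      (((x ^ 2 + ξ ^ 2) / 2 * Real.cot α - x * ξ * (Real.sin α)⁻¹ : ℝ) : ℂ))

/-- The `n`-dimensional fractional Fourier kernel `K_α(x, ξ) = ∏ₖ K_{αₖ}(xₖ, ξₖ)`. -/
def frftKernel {n : ℕ} (α : Fin n → ℝ) (x ξ : Rn n) : ℂ := ∏ k, frftKernelOne (α k) (x k) (ξ k)

/-- The fractional Fourier transform of a function, `(𝓕_α f)(ξ) = ∫ f(x) K_α(x, ξ) dx`. -/
def frftFun {n : ℕ} (α : Fin n → ℝ) (f : Rn n → ℂ) (ξ : Rn n) : ℂ := ∫ x, f x * frftKernel α x ξ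

/-! The fractional Fourier transform maps `𝓢(ℝⁿ)` continuously into itself: up to multiplication by
chirps and a linear change of variables it is the Fourier transform. -/

theorem hasTemperateGrowth_cexp_I :
    Function.HasTemperateGrowth (fun t : ℝ => Complex.exp (Complex.I * (t : ℂ))) := by
  have hd : ∀ n : ℕ, iteratedDeriv n (fun t : ℝ => Complex.exp (Complex.I * (t : ℂ))) =
      fun t : ℝ => Complex.I ^ n * Complex.exp (Complex.I * (t : ℂ)) := by
    intro n
    induction n with
    | zero => simp
    | succ n ih =>
      rw [iteratedDeriv_succ, ih]
      funext t
      have h1 : HasDerivAt (fun t : ℝ => Complex.I * (t : ℂ)) (Complex.I * 1) t :=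
        (Complex.ofRealCLM.hasDerivAt (x := t)).const_mul Complex.I
      have h2 := (h1.cexp).const_mul (Complex.I ^ n)
      rw [h2.deriv]
      ring
  refine ⟨?_, fun n => ⟨0, 1, fun t => ?_⟩⟩
  · exact Complex.contDiff_exp.comp (contDiff_const.mul Complex.ofRealCLM.contDiff)
  · rw [norm_iteratedFDeriv_eq_norm_iteratedDeriv, hd]
    simp [mul_comm Complex.I, Complex.norm_exp_ofReal_mul_I]

/-- The chirp `exp(i ∑ₖ xₖ² cot(αₖ) / 2)`. -/
def chirp {n : ℕ} (α : Fin n → ℝ) (x : Rn n) : ℂ :=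
  Complex.exp (Complex.I * ((∑ k, x k ^ 2 / 2 * Real.cot (α k) : ℝ) : ℂ))

theorem hasTemperateGrowth_chirp {n : ℕ} (α : Fin n → ℝ) :
    Function.HasTemperateGrowth (chirp α) := by
  have hc : ∀ k : Fin n, Function.HasTemperateGrowth (fun x : Rn n => x k) := fun k =>
    (EuclideanSpace.proj (𝕜 := ℝ) k).hasTemperateGrowth
  have h : Function.HasTemperateGrowth
      (fun x : Rn n => ∑ k, x k ^ 2 / 2 * Real.cot (α k)) := by
    apply Function.HasTemperateGrowth.sum
    intro k _
    have h2 := ((hc k).pow 2).mul (Function.HasTemperateGrowth.const (Real.cot (α k) / 2))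
    have h3 : (fun x : Rn n => x k ^ 2 / 2 * Real.cot (α k)) =
        (fun x : Rn n => x k) ^ 2 * fun _ => Real.cot (α k) / 2 := by
      funext x
      simp only [Pi.mul_apply, Pi.pow_apply]
      ring
    rw [h3]
    exact h2
  exact hasTemperateGrowth_cexp_I.comp h

theorem IsOrder.sin_ne_zero {n : ℕ} {α : Fin n → ℝ} (hα : IsOrder α) (k : Fin n) :
    Real.sin (α k) ≠ 0 := by
  intro h
  exact (hα k).2 ((Real.sin_eq_zero_iff_of_lt_of_lt (hα k).1.1 (hα k).1.2).1 h)

/-- The linear change of variables `ξ ↦ (ξₖ csc(αₖ) / 2π)ₖ`. -/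
def scaling {n : ℕ} (α : Fin n → ℝ) (hα : IsOrder α) : Rn n ≃L[ℝ] Rn n :=
  LinearEquiv.toContinuousLinearEquiv
    { toFun := fun ξ => WithLp.toLp 2 fun k => ξ k * ((Real.sin (α k))⁻¹ / (2 * Real.pi))
      invFun := fun ξ => WithLp.toLp 2 fun k => ξ k * (Real.sin (α k) * (2 * Real.pi))
      map_add' := fun x y => by ext k; simp [add_mul]
      map_smul' := fun c x => by ext k; simp [mul_assoc]
      left_inv := fun x => by
        ext k
        have := hα.sin_ne_zero k
        have := Real.pi_ne_zero
        field_simp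
      right_inv := fun x => by
        ext k
        have := hα.sin_ne_zero k
        have := Real.pi_ne_zero
        field_simp }

theorem scaling_apply {n : ℕ} (α : Fin n → ℝ) (hα : IsOrder α) (ξ : Rn n) (k : Fin n) :
    scaling α hα ξ k = ξ k * ((Real.sin (α k))⁻¹ / (2 * Real.pi)) := rfl

/-- Auxiliary form of the fractional Fourier transform on `𝓢(ℝⁿ)`. -/
def frftAux {n : ℕ} (α : Fin n → ℝ) (hα : IsOrder α) : 𝓢(Rn n, ℂ) →L[ℂ] 𝓢(Rn n, ℂ) :=
  (∏ k, frftConst (α k)) •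
    (SchwartzMap.smulLeftCLM ℂ (chirp α) ∘L
      SchwartzMap.compCLMOfContinuousLinearEquiv ℂ (scaling α hα) ∘L
        SchwartzMap.fourierTransformCLM ℂ ∘L SchwartzMap.smulLeftCLM ℂ (chirp α))

theorem frftKernel_eq {n : ℕ} (α : Fin n → ℝ) (hα : IsOrder α) (x ξ : Rn n) :
    frftKernel α x ξ = (∏ k, frftConst (α k)) * (chirp α ξ *
      (Complex.exp (((-2 * Real.pi * inner ℝ x (scaling α hα ξ) : ℝ) : ℂ) * Complex.I) *
        chirp α x)) := by
  unfold frftKernel frftKernelOne chirp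
  rw [Finset.prod_mul_distrib, ← Complex.exp_sum, ← Complex.exp_add, ← Complex.exp_add]
  congr 2
  rw [← Finset.mul_sum, mul_comm (Complex.ofReal _) Complex.I, ← mul_add, ← mul_add]
  congr 1
  rw [← Complex.ofReal_sum, ← Complex.ofReal_add, ← Complex.ofReal_add]
  congr 1
  rw [PiLp.inner_apply, Finset.mul_sum, ← Finset.sum_add_distrib, ← Finset.sum_add_distrib]
  refine Finset.sum_congr rfl fun k _ => ?_
  rw [scaling_apply]
  have := Real.pi_ne_zero
  have := hα.sin_ne_zero k
  simp only [RCLike.inner_apply, conj_trivial]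
  field_simp
  ring

theorem frftAux_apply {n : ℕ} (α : Fin n → ℝ) (hα : IsOrder α) (φ : 𝓢(Rn n, ℂ)) (ξ : Rn n) :
    frftAux α hα φ ξ = frftFun α φ ξ := by
  have hc := hasTemperateGrowth_chirp α
  simp only [frftAux, smul_apply, ContinuousLinearMap.comp_apply,
    SchwartzMap.smulLeftCLM_apply_apply hc,
    SchwartzMap.compCLMOfContinuousLinearEquiv_apply, Function.comp_apply,
    SchwartzMap.fourierTransformCLM_apply, SchwartzMap.fourier_coe, Real.fourier_eq', smul_eq_mul]
  unfold frftFun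
  rw [← integral_const_mul, ← integral_const_mul]
  refine integral_congr_ae (Filter.Eventually.of_forall fun x => ?_)
  simp only [frftKernel_eq α hα]
  ring

theorem frftAux_coe {n : ℕ} (α : Fin n → ℝ) (hα : IsOrder α) (φ : 𝓢(Rn n, ℂ)) :
    (frftAux α hα φ : Rn n → ℂ) = frftFun α φ := funext (frftAux_apply α hα φ)

/-- The fractional Fourier transform of a Schwartz function, as a Schwartz function. -/
def frftSchwartz {n : ℕ} (α : Fin n → ℝ) (hα : IsOrder α) (φ : 𝓢(Rn n, ℂ)) : 𝓢(Rn n, ℂ) where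
  toFun := frftFun α φ
  smooth' := frftAux_coe α hα φ ▸ (frftAux α hα φ).smooth'
  decay' := frftAux_coe α hα φ ▸ (frftAux α hα φ).decay'

theorem frftSchwartz_eq {n : ℕ} (α : Fin n → ℝ) (hα : IsOrder α) (φ : 𝓢(Rn n, ℂ)) :
    frftSchwartz α hα φ = frftAux α hα φ :=
  SchwartzMap.ext fun ξ => (frftAux_apply α hα φ ξ).symm

/-- The fractional Fourier transform as a continuous linear map `𝓢(ℝⁿ) → 𝓢(ℝⁿ)`. -/
def frft {n : ℕ} (α : Fin n → ℝ) (hα : IsOrder α) : 𝓢(Rn n, ℂ) →L[ℂ] 𝓢(Rn n, ℂ) where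
  toFun := frftSchwartz α hα
  map_add' φ χ := by simp only [frftSchwartz_eq, map_add]
  map_smul' c φ := by simp only [frftSchwartz_eq, map_smul, RingHom.id_apply]
  cont := by
    have h : frftSchwartz α hα = frftAux α hα := funext (frftSchwartz_eq α hα)
    rw [h]
    exact (frftAux α hα).cont

/-- The fractional Fourier transform of a tempered distribution, by duality:
`⟨𝓕_α f, φ⟩ = ⟨f, 𝓕_α φ⟩`. -/
def frftDistribution {n : ℕ} (α : Fin n → ℝ) (hα : IsOrder α) (f : 𝓢'(Rn n, ℂ)) :
    𝓢'(Rn n, ℂ) := PointwiseConvergenceCLM.precomp ℂ (frft α hα) f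

theorem frftDistribution_apply {n : ℕ} (α : Fin n → ℝ) (hα : IsOrder α) (f : 𝓢'(Rn n, ℂ))
    (φ : 𝓢(Rn n, ℂ)) : frftDistribution α hα f φ = f (frft α hα φ) := rfl

/-- The directional window `x ↦ conj(ψ(x·u - b))`. -/
def window {n : ℕ} (ψ : 𝓢(ℝ, ℂ)) (u : Sn n) (b : ℝ) (x : Rn n) : ℂ :=
  conj (ψ (inner ℝ x (u : Rn n) - b))

theorem hasTemperateGrowth_window {n : ℕ} (ψ : 𝓢(ℝ, ℂ)) (u : Sn n) (b : ℝ) :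
    Function.HasTemperateGrowth (window ψ u b) := by
  have h1 : Function.HasTemperateGrowth (fun x : Rn n => inner ℝ x (u : Rn n) - b) :=
    (Function.hasTemperateGrowth_inner_left (u : Rn n)).sub (Function.HasTemperateGrowth.const b)
  have h2 : Function.HasTemperateGrowth (fun z : ℂ => conj z) :=
    (Complex.conjCLE : ℂ ≃L[ℝ] ℂ).hasTemperateGrowth
  exact h2.comp (ψ.hasTemperateGrowth.comp h1)

/-- The product `f · conj(ψ(· u - b))` of a tempered distribution and a directional window:
`⟨f · w, φ⟩ = ⟨f, w φ⟩`. -/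
def windowed {n : ℕ} (ψ : 𝓢(ℝ, ℂ)) (u : Sn n) (b : ℝ) (f : 𝓢'(Rn n, ℂ)) : 𝓢'(Rn n, ℂ) :=
  TemperedDistribution.smulLeftCLM ℂ (window ψ u b) f

/-- The product of a Schwartz function and a directional window, as a Schwartz function. -/
def windowedTest {n : ℕ} (ψ : 𝓢(ℝ, ℂ)) (u : Sn n) (b : ℝ) (φ : 𝓢(Rn n, ℂ)) : 𝓢(Rn n, ℂ) where
  toFun x := window ψ u b x * φ x
  smooth' := by
    have h := SchwartzMap.smulLeftCLM_apply (hasTemperateGrowth_window ψ u b) φ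
    exact h ▸ (SchwartzMap.smulLeftCLM ℂ (window ψ u b) φ).smooth'
  decay' := by
    have h := SchwartzMap.smulLeftCLM_apply (hasTemperateGrowth_window ψ u b) φ
    exact h ▸ (SchwartzMap.smulLeftCLM ℂ (window ψ u b) φ).decay'

theorem windowed_apply {n : ℕ} (ψ : 𝓢(ℝ, ℂ)) (u : Sn n) (b : ℝ) (f : 𝓢'(Rn n, ℂ))
    (φ : 𝓢(Rn n, ℂ)) : windowed ψ u b f φ = f (windowedTest ψ u b φ) := by
  have h : windowedTest ψ u b φ = SchwartzMap.smulLeftCLM ℂ (window ψ u b) φ :=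
    SchwartzMap.ext fun x =>
      (SchwartzMap.smulLeftCLM_apply_apply (hasTemperateGrowth_window ψ u b) φ x).symm
  rw [h]
  rfl

/-- The directional short-time fractional Fourier transform of a function,
`(DS_ψ^α g)(u, b, a) = ∫ g(x) conj(ψ(u·x - b)) K_α(x, a) dx`. -/
def dstfrft {n : ℕ} (α : Fin n → ℝ) (ψ : 𝓢(ℝ, ℂ)) (g : Rn n → ℂ) (u : Sn n) (b : ℝ)
    (a : Rn n) : ℂ :=
  ∫ x, g x * window ψ u b x * frftKernel α x a

/-- Complex conjugation of Schwartz functions. -/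
def conjTest {n : ℕ} (φ : 𝓢(Rn n, ℂ)) : 𝓢(Rn n, ℂ) where
  toFun x := conj (φ x)
  smooth' := (φ.postcompCLM (Complex.conjCLE : ℂ →L[ℝ] ℂ)).smooth'
  decay' := (φ.postcompCLM (Complex.conjCLE : ℂ →L[ℝ] ℂ)).decay'

theorem dstfrft_eq {n : ℕ} (α : Fin n → ℝ) (hα : IsOrder α) (η : 𝓢(ℝ, ℂ)) (φ : 𝓢(Rn n, ℂ))
    (u : Sn n) (b : ℝ) (a : Rn n) :
    dstfrft α η (conjTest φ) u b a = frft α hα (windowedTest η u b (conjTest φ)) a := by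
  refine integral_congr_ae (Filter.Eventually.of_forall fun x => ?_)
  change _ = (window η u b x * conjTest φ x) * frftKernel α x a
  ring

/-- The test function `a ↦ conj((DS_η^α (conj φ))(u, b, a))` in `𝓢(ℝⁿ)`. -/
def dstfrftTest {n : ℕ} (α : Fin n → ℝ) (hα : IsOrder α) (η : 𝓢(ℝ, ℂ)) (φ : 𝓢(Rn n, ℂ))
    (u : Sn n) (b : ℝ) : 𝓢(Rn n, ℂ) where
  toFun a := conj (dstfrft α η (fun x => conj (φ x)) u b a)
  smooth' := by
    have h := funext (dstfrft_eq α hα η φ u b)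
    have h2 := (conjTest (frft α hα (windowedTest η u b (conjTest φ)))).smooth'
    exact (congrArg (fun F : Rn n → ℂ => ContDiff ℝ ∞ fun a => conj (F a)) h).mpr h2
  decay' := by
    have h := funext (dstfrft_eq α hα η φ u b)
    have h2 := (conjTest (frft α hα (windowedTest η u b (conjTest φ)))).decay'
    exact (congrArg (fun F : Rn n → ℂ => ∀ k m : ℕ, ∃ C : ℝ, ∀ x,
      ‖x‖ ^ k * ‖iteratedFDeriv ℝ m (fun a => conj (F a)) x‖ ≤ C) h).mpr h2

end DSTFRFT

end

open MeasureTheory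
open scoped SchwartzMap ComplexConjugate ContDiff FourierTransform

noncomputable section

/-! ### Inversion of the fractional Fourier transform -/

namespace DSTFRFT

/-! The inversion identity `frft_conjTest_frft` removes both fractional Fourier transforms from the
pairing. What remains is `f` applied to the test function `x ↦ g (u·x - b) φ(x)`, where `g = conj ψ
· η`. For fixed `x` and `u`, translation and reflection invariance in `b` gives `∫ g (u·x - b) db =
(η, ψ)`, and the sphere has mass one. Hence `(η, ψ) φ` is the pointwise integral of these test
functions over `(u, b)`.

It remains to move `f` inside the integral (`integrable_and_integral_apply`). A tempered
distribution is bounded by finitely many Schwartz seminorms, so by Hahn–Banach it factors through a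
continuous functional on a finite product of Banach spaces of bounded continuous weighted
derivatives. There it commutes with the Bochner integral.

Bochner integrability needs two facts about the family: it is continuous in `(u, b)`
(`continuous_smulLeftCLM_ridge`), and each of its seminorms is at most `C / (1 + b²)` uniformly in
`u` (`exists_seminorm_smulLeftCLM_ridge_le`). Fubini then gives the iterated integral. -/

theorem norm_sq_frftConst {α : ℝ} (hα : Real.sin α ≠ 0) :
    ‖frftConst α‖ ^ 2 = |(Real.sin α)⁻¹ / (2 * Real.pi)| := by
  have h1 : frftConst α ^ 2 = (1 - Complex.I * (Real.cot α : ℂ)) / (2 * Real.pi : ℂ) := by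
    have := Complex.cpow_nat_inv_pow
      ((1 - Complex.I * (Real.cot α : ℂ)) / (2 * Real.pi : ℂ)) two_ne_zero
    simpa only [frftConst, Complex.sqrt, Nat.cast_ofNat] using this
  -- This is `1 + cot² = csc²`.
  have h2 : ‖1 - Complex.I * (Real.cot α : ℂ)‖ = |(Real.sin α)⁻¹| := by
    rw [← abs_of_nonneg (norm_nonneg (1 - Complex.I * (Real.cot α : ℂ))), ← sq_eq_sq_iff_abs_eq_abs,
      ← Complex.normSq_eq_norm_sq, Complex.normSq_apply]
    simp only [Complex.sub_re, Complex.one_re, Complex.mul_re, Complex.I_re, Complex.ofReal_re,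
      zero_mul, Complex.I_im, Complex.ofReal_im, mul_zero, sub_zero, Complex.sub_im,
      Complex.one_im, Complex.mul_im, one_mul, zero_add, zero_sub, mul_one]
    rw [Real.cot_eq_cos_div_sin]
    field_simp
    linarith [Real.sin_sq_add_cos_sq α]
  rw [← norm_pow, h1, norm_div, h2, abs_div]
  simp [abs_of_pos Real.pi_pos]

theorem det_scaling {n : ℕ} (α : Fin n → ℝ) (hα : IsOrder α) :
    LinearMap.det ((scaling α hα : Rn n →L[ℝ] Rn n) : Rn n →ₗ[ℝ] Rn n) =
      ∏ k, (Real.sin (α k))⁻¹ / (2 * Real.pi) := by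
  have h : LinearMap.toMatrix (EuclideanSpace.basisFun (Fin n) ℝ).toBasis
      (EuclideanSpace.basisFun (Fin n) ℝ).toBasis
      ((scaling α hα : Rn n →L[ℝ] Rn n) : Rn n →ₗ[ℝ] Rn n) =
      Matrix.diagonal fun k => (Real.sin (α k))⁻¹ / (2 * Real.pi) := by
    ext i j
    rw [LinearMap.toMatrix_apply]
    by_cases hij : i = j
    · subst hij
      simp [scaling_apply]
    · simp [scaling_apply, hij]
  rw [← LinearMap.det_toMatrix (EuclideanSpace.basisFun (Fin n) ℝ).toBasis, h, Matrix.det_diagonal]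

/-- The product of the `|C_{αₖ}|²` is exactly the Jacobian of `scaling`, so the constants in the
transform and its conjugate cancel against the change of variables. -/
theorem integral_comp_scaling {n : ℕ} (α : Fin n → ℝ) (hα : IsOrder α) (g : Rn n → ℂ) :
    (∏ k, ‖frftConst (α k)‖ ^ 2 : ℝ) • ∫ x, g (scaling α hα x) = ∫ x, g x := by
  have hc : (∏ k, ‖frftConst (α k)‖ ^ 2 : ℝ) =
      |(scaling α hα : Rn n →L[ℝ] Rn n).det| := by
    rw [ContinuousLinearMap.det, det_scaling, Finset.abs_prod]
    exact Finset.prod_congr rfl fun k _ => norm_sq_frftConst (hα.sin_ne_zero k)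
  have h := integral_image_eq_integral_abs_det_fderiv_smul (volume : Measure (Rn n))
    (s := Set.univ) MeasurableSet.univ
    (fun x _ => ((scaling α hα).hasFDerivAt (x := x)).hasFDerivWithinAt)
    (scaling α hα).injective.injOn g
  rw [Set.image_univ, (scaling α hα).surjective.range_eq] at h
  simp only [Measure.restrict_univ] at h
  rw [h, integral_smul, hc]

theorem inner_scaling {n : ℕ} (α : Fin n → ℝ) (hα : IsOrder α) (x y : Rn n) :
    inner ℝ x (scaling α hα y) = inner ℝ (scaling α hα x) y := by
  simp only [PiLp.inner_apply, scaling_apply, RCLike.inner_apply, conj_trivial]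
  exact Finset.sum_congr rfl fun k _ => by ring

theorem chirp_mul_conj {n : ℕ} (α : Fin n → ℝ) (x : Rn n) : chirp α x * conj (chirp α x) = 1 := by
  rw [Complex.mul_conj, Complex.normSq_eq_norm_sq, chirp, mul_comm Complex.I,
    Complex.norm_exp_ofReal_mul_I]
  simp

/-- Inversion of the fractional Fourier transform, in the form `𝓕_α (conj (𝓕_α h)) = conj h`. -/
theorem frft_conjTest_frft {n : ℕ} (α : Fin n → ℝ) (hα : IsOrder α) (h : 𝓢(Rn n, ℂ)) :
    frft α hα (conjTest (frft α hα h)) = conjTest h := by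
  ext ξ
  set k : 𝓢(Rn n, ℂ) := SchwartzMap.smulLeftCLM ℂ (chirp α) h with hk
  have hk' : ∀ x, k x = chirp α x * h x := fun x => by
    rw [hk, SchwartzMap.smulLeftCLM_apply_apply (hasTemperateGrowth_chirp α), smul_eq_mul]
  set c : ℂ := ∏ k, frftConst (α k) with hc
  have h1 : ∀ x, frft α hα h x = c * (chirp α x * 𝓕 k (scaling α hα x)) := fun x => by
    change frftFun α h x = _
    rw [← frftAux_apply α hα]
    simp only [frftAux, smul_apply, ContinuousLinearMap.comp_apply,
      SchwartzMap.smulLeftCLM_apply_apply (hasTemperateGrowth_chirp α),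
      SchwartzMap.compCLMOfContinuousLinearEquiv_apply, Function.comp_apply,
      SchwartzMap.fourierTransformCLM_apply, smul_eq_mul, ← hk, ← hc]
  have hcc : conj c * c = ((∏ k, ‖frftConst (α k)‖ ^ 2 : ℝ) : ℂ) := by
    rw [hc, map_prod, ← Finset.prod_mul_distrib, Complex.ofReal_prod]
    refine Finset.prod_congr rfl fun k _ => ?_
    rw [mul_comm, Complex.mul_conj, Complex.normSq_eq_norm_sq]
  -- This is the conjugate of ordinary Fourier inversion for `k`, the chirped input.
  have hinv : ∫ y, conj (Complex.exp (((2 * Real.pi * inner ℝ y ξ : ℝ) : ℂ) * Complex.I) *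
      𝓕 k y) = conj (k ξ) := by
    rw [integral_conj]
    congr 1
    have : 𝓕⁻ (𝓕 k) ξ = k ξ := by rw [FourierTransform.fourierInv_fourier_eq]
    rw [← this, SchwartzMap.fourierInv_coe, Real.fourierInv_eq']
    simp only [smul_eq_mul]
  calc frft α hα (conjTest (frft α hα h)) ξ
      = ∫ x, conj (frft α hα h x) * frftKernel α x ξ := rfl
    _ = ∫ x, chirp α ξ * (conj c * c) *
          conj (Complex.exp (((2 * Real.pi * inner ℝ (scaling α hα x) ξ : ℝ) : ℂ) * Complex.I) *
            𝓕 k (scaling α hα x)) := by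
        refine integral_congr_ae (Filter.Eventually.of_forall fun x => ?_)
        simp only [h1, frftKernel_eq α hα, map_mul, ← Complex.exp_conj, Complex.conj_I,
          Complex.conj_ofReal, inner_scaling, ← hc]
        rw [show ((-2 * Real.pi * inner ℝ (scaling α hα x) ξ : ℝ) : ℂ) * Complex.I =
          ((2 * Real.pi * inner ℝ (scaling α hα x) ξ : ℝ) : ℂ) * -Complex.I by push_cast; ring]
        -- The kernel's chirp in `x` cancels the conjugated outer chirp of `𝓕_α h`.
        linear_combination (conj c * c * chirp α ξ * conj (𝓕 k (scaling α hα x)) *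
          Complex.exp (((2 * Real.pi * inner ℝ (scaling α hα x) ξ : ℝ) : ℂ) * -Complex.I)) *
          chirp_mul_conj α x
    _ = chirp α ξ * conj (k ξ) := by
        rw [integral_const_mul, hcc, mul_assoc, ← Complex.real_smul,
          integral_comp_scaling α hα fun y => conj (Complex.exp
            (((2 * Real.pi * inner ℝ y ξ : ℝ) : ℂ) * Complex.I) * 𝓕 k y), hinv]
    _ = conjTest h ξ := by
        rw [hk', map_mul, ← mul_assoc, chirp_mul_conj, one_mul]
        rfl

/-- The pairing in the desingularization formula, without fractional Fourier transforms. -/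
theorem frftDistribution_windowed_dstfrftTest {n : ℕ} (α : Fin n → ℝ) (hα : IsOrder α)
    (f : 𝓢'(Rn n, ℂ)) (ψ η : 𝓢(ℝ, ℂ)) (φ : 𝓢(Rn n, ℂ)) (u : Sn n) (b : ℝ) :
    frftDistribution α hα (windowed ψ u b f) (dstfrftTest α hα η φ u b) =
      f (windowedTest ψ u b (conjTest (windowedTest η u b (conjTest φ)))) := by
  have h : dstfrftTest α hα η φ u b =
      conjTest (frft α hα (windowedTest η u b (conjTest φ))) :=
    SchwartzMap.ext fun a => congrArg conj (dstfrft_eq α hα η φ u b a)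
  rw [frftDistribution_apply, windowed_apply, h, frft_conjTest_frft]

end DSTFRFT

/-! ### Tempered distributions and integrals of Schwartz functions -/

/-- A linear functional that is dominated by the norm of a linear map into a normed space factors
through a continuous functional on that space. -/
theorem exists_strongDual_comp_eq {𝕜 X B : Type*} [RCLike 𝕜] [AddCommGroup X] [Module 𝕜 X]
    [NormedAddCommGroup B] [NormedSpace 𝕜 B] (T : X →ₗ[𝕜] B) (f : X →ₗ[𝕜] 𝕜) (C : ℝ)
    (hT : ∀ x, ‖f x‖ ≤ C * ‖T x‖) : ∃ G : StrongDual 𝕜 B, ∀ x, f x = G (T x) := by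
  -- The bound makes `f` vanish on `ker T`, so `f` descends to the range of `T`; Hahn–Banach extends
  -- it from there.
  have hker : LinearMap.ker T ≤ LinearMap.ker f := by
    intro x hx
    have := hT x
    rw [LinearMap.mem_ker.1 hx, norm_zero, mul_zero] at this
    exact norm_le_zero_iff.1 this
  let ℓ : LinearMap.range T →ₗ[𝕜] 𝕜 :=
    (LinearMap.ker T).liftQ f hker ∘ₗ (T.quotKerEquivRange.symm : LinearMap.range T →ₗ[𝕜] _)
  have hℓT : ∀ x, ℓ ⟨T x, x, rfl⟩ = f x := fun x => by
    have h2 : T.quotKerEquivRange.symm ⟨T x, x, rfl⟩ = (LinearMap.ker T).mkQ x := by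
      rw [LinearEquiv.symm_apply_eq]
      rfl
    simp [ℓ, h2]
  obtain ⟨G, hG, -⟩ := exists_extension_norm_eq (LinearMap.range T) (ℓ.mkContinuous C (by
    rintro ⟨_, x, rfl⟩
    rw [hℓT]
    exact hT x))
  refine ⟨G, fun x => ?_⟩
  have := hG ⟨T x, x, rfl⟩
  rw [LinearMap.mkContinuous_apply, hℓT] at this
  exact this.symm

namespace SchwartzMap

section Integral

variable (𝕜 : Type*) {E F Y : Type*} [RCLike 𝕜] [NormedAddCommGroup E] [NormedSpace ℝ E]
  [NormedAddCommGroup F] [NormedSpace ℝ F] [NormedSpace 𝕜 F] [SMulCommClass ℝ 𝕜 F]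

variable (E F) in
/-- Bounded continuous functions with values in the multilinear maps of degree `m`, with respect to
the metric of the operator norm. -/
abbrev BoundedMultilinear (m : ℕ) : Type _ :=
  @BoundedContinuousFunction E (E [×m]→L[ℝ] F) _
    (@SeminormedAddCommGroup.toPseudoMetricSpace _ NormedAddCommGroup.toSeminormedAddCommGroup)

/-- The weighted derivative `x ↦ ‖x‖ ^ k • iteratedFDeriv ℝ m φ x` as a bounded continuous
function. -/
def weightedIteratedFDeriv (k m : ℕ) : 𝓢(E, F) →L[𝕜] BoundedMultilinear E F m :=
  mkCLMtoNormedSpace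
    (fun φ => BoundedContinuousFunction.ofNormedAddCommGroup
      (fun x => ‖x‖ ^ k • iteratedFDeriv ℝ m φ x)
      ((continuous_norm.pow k).smul ((φ.smooth m).continuous_iteratedFDeriv le_rfl))
      (SchwartzMap.seminorm ℝ k m φ) fun x => by
        rw [norm_smul, norm_pow, norm_norm]
        exact φ.le_seminorm ℝ k m x)
    (fun φ χ => by
      ext1 x
      simp [FunLike.coe_add, iteratedFDeriv_add (φ.smooth m) (χ.smooth m), smul_add])
    (fun c φ => by
      ext1 x
      simp only [BoundedContinuousFunction.coe_ofNormedAddCommGroup, RingHom.id_apply,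
        BoundedContinuousFunction.coe_smul, FunLike.coe_smul]
      rw [iteratedFDeriv_const_smul_apply ((φ.smooth m).contDiffAt), smul_comm])
    ⟨{(k, m)}, 1, zero_le_one, fun φ => by
      rw [one_mul, Finset.sup_singleton]
      refine BoundedContinuousFunction.norm_ofNormedAddCommGroup_le _
        (apply_nonneg _ _) fun x => ?_
      rw [norm_smul, norm_pow, norm_norm]
      exact φ.le_seminorm 𝕜 k m x⟩

theorem weightedIteratedFDeriv_apply (k m : ℕ) (φ : 𝓢(E, F)) (x : E) :
    weightedIteratedFDeriv 𝕜 k m φ x = ‖x‖ ^ k • iteratedFDeriv ℝ m φ x := rfl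

theorem norm_weightedIteratedFDeriv_le (k m : ℕ) (φ : 𝓢(E, F)) :
    ‖weightedIteratedFDeriv 𝕜 k m φ‖ ≤ SchwartzMap.seminorm 𝕜 k m φ := by
  refine (BoundedContinuousFunction.norm_le (apply_nonneg _ _)).2 fun x => ?_
  rw [weightedIteratedFDeriv_apply, norm_smul, norm_pow, norm_norm]
  exact φ.le_seminorm 𝕜 k m x

/-- Together with the opposite bound, the seminorm is the sup norm of the weighted derivative, so
seminorm bounds on `f` become norm bounds. -/
theorem seminorm_le_norm_weightedIteratedFDeriv (k m : ℕ) (φ : 𝓢(E, F)) :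
    SchwartzMap.seminorm 𝕜 k m φ ≤ ‖weightedIteratedFDeriv 𝕜 k m φ‖ := by
  refine φ.seminorm_le_bound 𝕜 k m (norm_nonneg _) fun x => ?_
  have h := (weightedIteratedFDeriv 𝕜 k m φ).norm_coe_le_norm x
  rwa [weightedIteratedFDeriv_apply, norm_smul, norm_pow, norm_norm] at h

/-- A continuous functional on the Schwartz space extends to finitely many weighted derivatives. -/
theorem exists_strongDual_comp_weightedIteratedFDeriv (f : 𝓢(E, F) →L[𝕜] 𝕜) :
    ∃ (s : Finset (ℕ × ℕ)) (G : StrongDual 𝕜 (∀ i : s, BoundedMultilinear E F i.1.2)),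
      ∀ φ, f φ = G fun i => weightedIteratedFDeriv 𝕜 i.1.1 i.1.2 φ := by
  obtain ⟨s, C, -, hC⟩ := Seminorm.bound_of_continuous (schwartz_withSeminorms 𝕜 E F)
    ((normSeminorm 𝕜 𝕜).comp (f : 𝓢(E, F) →ₗ[𝕜] 𝕜)) f.continuous.norm
  let T : 𝓢(E, F) →ₗ[𝕜] (∀ i : s, BoundedMultilinear E F i.1.2) :=
    LinearMap.pi fun i => (weightedIteratedFDeriv 𝕜 i.1.1 i.1.2).toLinearMap
  have hT : ∀ φ, ‖f φ‖ ≤ C * ‖T φ‖ := fun φ => by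
    refine (hC φ).trans ?_
    rw [smul_apply, NNReal.smul_def, smul_eq_mul]
    refine mul_le_mul_of_nonneg_left (Seminorm.finset_sup_apply_le (norm_nonneg _) fun i hi => ?_)
      C.coe_nonneg
    exact (seminorm_le_norm_weightedIteratedFDeriv 𝕜 i.1 i.2 φ).trans (norm_le_pi_norm (T φ) ⟨i, hi⟩)
  obtain ⟨G, hG⟩ := exists_strongDual_comp_eq T (f : 𝓢(E, F) →ₗ[𝕜] 𝕜) C hT
  exact ⟨s, G, hG⟩

variable [TopologicalSpace Y] [SecondCountableTopology Y] [MeasurableSpace Y]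
  [OpensMeasurableSpace Y] {ν : Measure Y} {Φ : Y → 𝓢(E, F)}

/-- Continuity of the family supplies strong measurability, and the seminorm bound supplies the
integrable majorant. -/
theorem integrable_weightedIteratedFDeriv (hΦ : Continuous Φ) {k m : ℕ}
    (hk : ∃ B : Y → ℝ, Integrable B ν ∧ ∀ y, SchwartzMap.seminorm 𝕜 k m (Φ y) ≤ B y) :
    Integrable (fun y => weightedIteratedFDeriv 𝕜 k m (Φ y)) ν := by
  obtain ⟨B, hB, hle⟩ := hk
  exact hB.mono' ((weightedIteratedFDeriv 𝕜 k m).continuous.comp hΦ).aestronglyMeasurable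
    (Filter.Eventually.of_forall fun y =>
      (norm_weightedIteratedFDeriv_le 𝕜 k m (Φ y)).trans (hle y))

variable [CompleteSpace F]

/-- Differentiation under the integral sign for an integrable family of Schwartz functions. -/
theorem iteratedFDeriv_integral (hΦ : Continuous Φ)
    (hk : ∀ m, ∃ B : Y → ℝ, Integrable B ν ∧ ∀ y, SchwartzMap.seminorm ℝ 0 m (Φ y) ≤ B y) (m : ℕ) :
    iteratedFDeriv ℝ m (fun x => ∫ y, Φ y x ∂ν) =
      fun x => ∫ y, iteratedFDeriv ℝ m (Φ y) x ∂ν := by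
  have hint : ∀ m x, Integrable (fun y => iteratedFDeriv ℝ m (Φ y) x) ν := fun m x => by
    have := (BoundedContinuousFunction.evalCLM ℝ x).integrable_comp
      (integrable_weightedIteratedFDeriv ℝ hΦ (hk m))
    simpa [weightedIteratedFDeriv_apply] using this
  induction m with
  | zero =>
    ext1 x
    have h := (continuousMultilinearCurryFin0 ℝ E F).symm.toContinuousLinearEquiv.integral_comp_comm
      (fun y => Φ y x) (μ := ν)
    rw [iteratedFDeriv_zero_eq_comp]
    exact h.symm
  | succ m ih =>
    ext1 x
    obtain ⟨B, hB, hle⟩ := hk (m + 1)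
    have hcurry : ∀ y x, fderiv ℝ (iteratedFDeriv ℝ m (Φ y)) x =
        continuousMultilinearCurryLeftEquiv ℝ (fun _ : Fin (m + 1) => E) F
          (iteratedFDeriv ℝ (m + 1) (Φ y) x) := fun y x => by
      rw [iteratedFDeriv_succ_eq_comp_left, Function.comp_apply, LinearIsometryEquiv.apply_symm_apply]
    -- The order `m + 1` seminorm bounds the next derivative uniformly in `x`, so the domination
    -- holds on the whole space.
    have hd : HasFDerivAt (fun x => ∫ y, iteratedFDeriv ℝ m (Φ y) x ∂ν)
        (∫ y, fderiv ℝ (iteratedFDeriv ℝ m (Φ y)) x ∂ν) x := by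
      refine hasFDerivAt_integral_of_dominated_of_fderiv_le
        (F' := fun x y => fderiv ℝ (iteratedFDeriv ℝ m (Φ y)) x) (bound := B) (s := Set.univ)
        Filter.univ_mem (Filter.Eventually.of_forall fun x => (hint m x).aestronglyMeasurable)
        (hint m x) ?_ (Filter.Eventually.of_forall fun y x _ => ?_) hB
        (Filter.Eventually.of_forall fun y x _ => ?_)
      · simp only [hcurry]
        exact (LinearIsometryEquiv.continuous _).comp_aestronglyMeasurable
          (hint (m + 1) x).aestronglyMeasurable
      · rw [norm_fderiv_iteratedFDeriv]
        exact ((Φ y).norm_iteratedFDeriv_le_seminorm ℝ (m + 1) x).trans (hle y)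
      · exact (((Φ y).smooth (m + 1)).differentiable_iteratedFDeriv
          (by exact_mod_cast Nat.lt_succ_self m) x).hasFDerivAt
    rw [iteratedFDeriv_succ_eq_comp_left, Function.comp_apply, ih, hd.fderiv]
    simp only [hcurry]
    let L : (E [×(m + 1)]→L[ℝ] F) →L[ℝ] (E →L[ℝ] (E [×m]→L[ℝ] F)) :=
      ((continuousMultilinearCurryLeftEquiv ℝ (fun _ : Fin (m + 1) => E)
        F).toContinuousLinearEquiv.toContinuousLinearMap :)
    have h := ContinuousLinearMap.integral_comp_comm (𝕜 := ℝ) (E := E [×(m + 1)]→L[ℝ] F)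
      (Fₗ := E →L[ℝ] (E [×m]→L[ℝ] F)) L (hint (m + 1) x)
    exact (LinearIsometryEquiv.symm_apply_eq _).2 h

/-- Continuous functionals on the Schwartz space commute with integrals of continuous families
whose seminorms are integrable. -/
theorem integrable_and_integral_apply (f : 𝓢(E, F) →L[𝕜] 𝕜) (hΦ : Continuous Φ)
    (hk : ∀ k m, ∃ B : Y → ℝ, Integrable B ν ∧ ∀ y, SchwartzMap.seminorm ℝ k m (Φ y) ≤ B y)
    (χ : 𝓢(E, F)) (hχ : ∀ x, χ x = ∫ y, Φ y x ∂ν) :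
    Integrable (fun y => f (Φ y)) ν ∧ f χ = ∫ y, f (Φ y) ∂ν := by
  obtain ⟨s, G, hG⟩ := exists_strongDual_comp_weightedIteratedFDeriv 𝕜 f
  have hi : ∀ k m, Integrable (fun y => weightedIteratedFDeriv 𝕜 k m (Φ y)) ν := fun k m =>
    integrable_weightedIteratedFDeriv 𝕜 hΦ (hk k m)
  have hint : Integrable (fun y => fun i : s => weightedIteratedFDeriv 𝕜 i.1.1 i.1.2 (Φ y)) ν :=
    Integrable.of_eval fun i => hi i.1.1 i.1.2
  -- Checked componentwise and pointwise: the weight leaves the integral, and differentiation under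
  -- the integral sign does the rest.
  have hχ' : (fun i : s => weightedIteratedFDeriv 𝕜 i.1.1 i.1.2 χ) =
      ∫ y, (fun i : s => weightedIteratedFDeriv 𝕜 i.1.1 i.1.2 (Φ y)) ∂ν := by
    funext i
    rw [eval_integral fun i : s => hi i.1.1 i.1.2]
    ext1 x
    have h := (BoundedContinuousFunction.evalCLM ℝ x).integral_comp_comm (hi i.1.1 i.1.2)
    simp only [BoundedContinuousFunction.evalCLM_apply, weightedIteratedFDeriv_apply] at h
    rw [← h, weightedIteratedFDeriv_apply, integral_smul,
      ← congrFun (iteratedFDeriv_integral hΦ (hk 0) i.1.2) x, ← funext hχ]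
  refine ⟨?_, ?_⟩
  · simp only [hG]
    exact G.integrable_comp hint
  · rw [hG, hχ', ← G.integral_comp_comm hint]
    simp only [hG]

end Integral

end SchwartzMap

/-! ### Seminorm estimates for ridge functions -/

namespace SchwartzMap

section Ridge

variable {E : Type*} [NormedAddCommGroup E] [NormedSpace ℝ E]

/-- Leibniz bound for the product of a Schwartz function and a function whose derivatives grow at
most quadratically. -/
theorem seminorm_smulLeftCLM_le {h : E → ℂ} (hh : h.HasTemperateGrowth) (φ : 𝓢(E, ℂ)) (k m : ℕ)
    {A : ℕ → ℝ} (hA : ∀ i, 0 ≤ A i)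
    (hle : ∀ i x, ‖iteratedFDeriv ℝ i h x‖ ≤ A i * (1 + ‖x‖ ^ 2)) :
    SchwartzMap.seminorm ℝ k m (smulLeftCLM ℂ h φ) ≤ ∑ i ∈ Finset.range (m + 1),
      (m.choose i : ℝ) * (A i * (SchwartzMap.seminorm ℝ k (m - i) φ +
        SchwartzMap.seminorm ℝ (k + 2) (m - i) φ)) := by
  refine seminorm_le_bound ℝ k m _ (Finset.sum_nonneg fun i _ => mul_nonneg (Nat.cast_nonneg _)
    (mul_nonneg (hA i) (add_nonneg (apply_nonneg _ _) (apply_nonneg _ _)))) fun x => ?_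
  rw [smulLeftCLM_apply hh]
  refine (mul_le_mul_of_nonneg_left (norm_iteratedFDeriv_smul_le (N := m)
    (hh.1.of_le (by exact_mod_cast le_top)) (φ.smooth m) x le_rfl) (by positivity)).trans ?_
  rw [Finset.mul_sum]
  refine Finset.sum_le_sum fun i _ => ?_
  have h1 := φ.le_seminorm ℝ k (m - i) x
  have h2 := φ.le_seminorm ℝ (k + 2) (m - i) x
  calc ‖x‖ ^ k * ((m.choose i : ℝ) * ‖iteratedFDeriv ℝ i h x‖ * ‖iteratedFDeriv ℝ (m - i) φ x‖)
      ≤ ‖x‖ ^ k * ((m.choose i : ℝ) * (A i * (1 + ‖x‖ ^ 2)) *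
          ‖iteratedFDeriv ℝ (m - i) φ x‖) := by
        gcongr
        exact hle i x
    -- The quadratic growth is absorbed by raising the weight from `k` to `k + 2`.
    _ = (m.choose i : ℝ) * (A i * (‖x‖ ^ k * ‖iteratedFDeriv ℝ (m - i) φ x‖ +
          ‖x‖ ^ (k + 2) * ‖iteratedFDeriv ℝ (m - i) φ x‖)) := by ring
    _ ≤ _ := by
        have := hA i
        gcongr

theorem norm_iteratedFDeriv_le_div_one_add_sq (g : 𝓢(ℝ, ℂ)) (i : ℕ) (t : ℝ) :
    ‖iteratedFDeriv ℝ i g t‖ ≤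
      (SchwartzMap.seminorm ℝ 0 i g + SchwartzMap.seminorm ℝ 2 i g) / (1 + t ^ 2) := by
  rw [le_div_iff₀ (by positivity)]
  have h1 := g.norm_iteratedFDeriv_le_seminorm ℝ i t
  have h2 := g.le_seminorm ℝ 2 i t
  rw [Real.norm_eq_abs, sq_abs] at h2
  linarith

theorem norm_iteratedFDeriv_sub_le (g : 𝓢(ℝ, ℂ)) (i : ℕ) (s t : ℝ) :
    ‖iteratedFDeriv ℝ i g s - iteratedFDeriv ℝ i g t‖ ≤
      SchwartzMap.seminorm ℝ 0 (i + 1) g * |s - t| := by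
  refine Convex.norm_image_sub_le_of_norm_fderiv_le (𝕜 := ℝ) (s := Set.univ)
    (fun x _ => (g.smooth (i + 1)).differentiable_iteratedFDeriv
      (by exact_mod_cast Nat.lt_succ_self i) x) (fun x _ => ?_) convex_univ (Set.mem_univ t)
    (Set.mem_univ s)
  rw [norm_fderiv_iteratedFDeriv]
  exact g.norm_iteratedFDeriv_le_seminorm ℝ (i + 1) x

/-- The ridge function `x ↦ g (L x - b)`. -/
def ridge (g : 𝓢(ℝ, ℂ)) (p : (E →L[ℝ] ℝ) × ℝ) (x : E) : ℂ := g (p.1 x - p.2)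

theorem hasTemperateGrowth_ridge (g : 𝓢(ℝ, ℂ)) (p : (E →L[ℝ] ℝ) × ℝ) :
    (ridge g p).HasTemperateGrowth :=
  g.hasTemperateGrowth.comp
    (p.1.hasTemperateGrowth.sub (Function.HasTemperateGrowth.const p.2))

theorem iteratedFDeriv_ridge (g : 𝓢(ℝ, ℂ)) (p : (E →L[ℝ] ℝ) × ℝ) (i : ℕ) (x : E) :
    iteratedFDeriv ℝ i (ridge g p) x =
      (iteratedFDeriv ℝ i g (p.1 x - p.2)).compContinuousLinearMap fun _ => p.1 := by
  have h := p.1.iteratedFDeriv_comp_right (f := fun t => g (t - p.2)) (n := i) (i := i)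
    ((g.smooth i).comp (contDiff_id.sub contDiff_const)) x le_rfl
  rw [iteratedFDeriv_comp_sub] at h
  exact h

/-- A Peetre-type inequality trades the decay of `g` in `L x - b` for decay in `b`, at the price of
the factor `1 + ‖x‖²`. -/
theorem norm_iteratedFDeriv_ridge_le (g : 𝓢(ℝ, ℂ)) {p : (E →L[ℝ] ℝ) × ℝ} (hp : ‖p.1‖ ≤ 1) (i : ℕ)
    (x : E) : ‖iteratedFDeriv ℝ i (ridge g p) x‖ ≤
      2 * (SchwartzMap.seminorm ℝ 0 i g + SchwartzMap.seminorm ℝ 2 i g) * (1 + p.2 ^ 2)⁻¹ *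
        (1 + ‖x‖ ^ 2) := by
  have h0 : 0 ≤ SchwartzMap.seminorm ℝ 0 i g + SchwartzMap.seminorm ℝ 2 i g :=
    add_nonneg (apply_nonneg _ _) (apply_nonneg _ _)
  have hx : (p.1 x) ^ 2 ≤ ‖x‖ ^ 2 := by
    rw [sq_le_sq, abs_norm]
    simpa using p.1.le_of_opNorm_le hp x
  have h1 : (1 + (p.1 x - p.2) ^ 2)⁻¹ ≤ 2 * (1 + p.2 ^ 2)⁻¹ * (1 + ‖x‖ ^ 2) := by
    rw [inv_le_iff_one_le_mul₀ (by positivity), mul_assoc, mul_assoc, mul_left_comm,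
      ← div_eq_inv_mul, le_div_iff₀ (by positivity)]
    -- With `s = p.1 x` and `b = p.2`, use `s² ≤ ‖x‖²` and `2(s - b)² + 2s² - b² = (2s - b)²`.
    nlinarith [sq_nonneg (2 * p.1 x - p.2), mul_nonneg (sq_nonneg ‖x‖) (sq_nonneg (p.1 x - p.2))]
  rw [iteratedFDeriv_ridge]
  refine (ContinuousMultilinearMap.norm_compContinuousLinearMap_le _ _).trans ?_
  rw [Finset.prod_const, Finset.card_univ, Fintype.card_fin]
  calc ‖iteratedFDeriv ℝ i g (p.1 x - p.2)‖ * ‖p.1‖ ^ i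
      ≤ ‖iteratedFDeriv ℝ i g (p.1 x - p.2)‖ :=
        mul_le_of_le_one_right (norm_nonneg _) (pow_le_one₀ (norm_nonneg _) hp)
    _ ≤ _ := norm_iteratedFDeriv_le_div_one_add_sq g i _
    _ ≤ (SchwartzMap.seminorm ℝ 0 i g + SchwartzMap.seminorm ℝ 2 i g) *
          (2 * (1 + p.2 ^ 2)⁻¹ * (1 + ‖x‖ ^ 2)) := by
        rw [div_eq_mul_inv]
        gcongr
    _ = _ := by ring

/-- The coefficient of `1 + ‖x‖²` tends to zero as `p → q`; this drives the continuity of the ridge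
products in `p`. -/
theorem norm_iteratedFDeriv_ridge_sub_le (g : 𝓢(ℝ, ℂ)) (p q : (E →L[ℝ] ℝ) × ℝ) (i : ℕ) (x : E) :
    ‖iteratedFDeriv ℝ i (ridge g p - ridge g q) x‖ ≤
      (SchwartzMap.seminorm ℝ 0 (i + 1) g * (‖p.1 - q.1‖ + |p.2 - q.2|) * ‖p.1‖ ^ i +
        SchwartzMap.seminorm ℝ 0 i g *
          ‖ContinuousMultilinearMap.compContinuousLinearMapContinuousMultilinear ℝ
              (fun _ : Fin i => E) (fun _ => ℝ) ℂ (fun _ => p.1) -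
            ContinuousMultilinearMap.compContinuousLinearMapContinuousMultilinear ℝ
              (fun _ : Fin i => E) (fun _ => ℝ) ℂ (fun _ => q.1)‖) * (1 + ‖x‖ ^ 2) := by
  set K := ContinuousMultilinearMap.compContinuousLinearMapContinuousMultilinear ℝ
    (fun _ : Fin i => E) (fun _ => ℝ) ℂ
  have hc : ∀ (r : (E →L[ℝ] ℝ) × ℝ) (M : ℝ [×i]→L[ℝ] ℂ),
      (M.compContinuousLinearMap fun _ => r.1) = K (fun _ => r.1) M := fun r M => rfl
  have h1x : 1 ≤ 1 + ‖x‖ ^ 2 := by nlinarith [sq_nonneg ‖x‖]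
  have hδ : |(p.1 x - p.2) - (q.1 x - q.2)| ≤
      (‖p.1 - q.1‖ + |p.2 - q.2|) * (1 + ‖x‖ ^ 2) := by
    have h1 : |(p.1 - q.1) x| ≤ ‖p.1 - q.1‖ * ‖x‖ := (p.1 - q.1).le_opNorm x
    have h2 : (p.1 x - p.2) - (q.1 x - q.2) = (p.1 - q.1) x - (p.2 - q.2) := by
      rw [sub_apply]
      ring
    rw [h2]
    refine (abs_sub _ _).trans ?_
    have h3 : ‖x‖ ≤ 1 + ‖x‖ ^ 2 := by nlinarith [sq_nonneg (‖x‖ - 1)]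
    nlinarith [mul_le_mul_of_nonneg_left h3 (norm_nonneg (p.1 - q.1)),
      mul_le_mul_of_nonneg_left h1x (abs_nonneg (p.2 - q.2))]
  have hsm : ∀ r : (E →L[ℝ] ℝ) × ℝ, ContDiff ℝ i (ridge g r) := fun r =>
    (hasTemperateGrowth_ridge g r).1.of_le (by exact_mod_cast le_top)
  -- First the evaluation point moves with the pullback along `p.1` fixed (mean value bound); then
  -- the pullback moves with the point fixed (operator norm).
  have hsplit : iteratedFDeriv ℝ i (ridge g p - ridge g q) x =
      K (fun _ => p.1) (iteratedFDeriv ℝ i g (p.1 x - p.2) - iteratedFDeriv ℝ i g (q.1 x - q.2)) +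
        (K (fun _ => p.1) - K (fun _ => q.1)) (iteratedFDeriv ℝ i g (q.1 x - q.2)) := by
    rw [iteratedFDeriv_sub_apply (hsm p).contDiffAt (hsm q).contDiffAt,
      iteratedFDeriv_ridge, iteratedFDeriv_ridge, hc, hc, map_sub,
      sub_apply]
    abel
  rw [hsplit]
  refine (norm_add_le _ _).trans ?_
  rw [add_mul]
  refine add_le_add ?_ ?_
  · refine (ContinuousMultilinearMap.norm_compContinuousLinearMap_le _ _).trans ?_
    rw [Finset.prod_const, Finset.card_univ, Fintype.card_fin]
    calc _ ≤ SchwartzMap.seminorm ℝ 0 (i + 1) g *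
          ((‖p.1 - q.1‖ + |p.2 - q.2|) * (1 + ‖x‖ ^ 2)) * ‖p.1‖ ^ i := by
          gcongr
          refine (norm_iteratedFDeriv_sub_le g i _ _).trans ?_
          gcongr
      _ = _ := by ring
  · refine (ContinuousLinearMap.le_opNorm _ _).trans ?_
    calc _ ≤ ‖K (fun _ => p.1) - K (fun _ => q.1)‖ * SchwartzMap.seminorm ℝ 0 i g := by
          gcongr
          exact g.norm_iteratedFDeriv_le_seminorm ℝ i _
      _ ≤ _ := by
          rw [mul_comm]
          exact le_mul_of_one_le_right (mul_nonneg (apply_nonneg _ _) (norm_nonneg _)) h1x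

theorem continuous_smulLeftCLM_ridge (g : 𝓢(ℝ, ℂ)) (φ : 𝓢(E, ℂ)) :
    Continuous fun p : (E →L[ℝ] ℝ) × ℝ => smulLeftCLM ℂ (ridge g p) φ := by
  rw [continuous_iff_continuousAt]
  intro q
  refine ((schwartz_withSeminorms ℝ E ℂ).tendsto_nhds _ _).2 ?_
  rintro ⟨k, m⟩ ε hε
  let A : ((E →L[ℝ] ℝ) × ℝ) → ℕ → ℝ := fun p i =>
    SchwartzMap.seminorm ℝ 0 (i + 1) g * (‖p.1 - q.1‖ + |p.2 - q.2|) * ‖p.1‖ ^ i +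
      SchwartzMap.seminorm ℝ 0 i g *
        ‖ContinuousMultilinearMap.compContinuousLinearMapContinuousMultilinear ℝ
            (fun _ : Fin i => E) (fun _ => ℝ) ℂ (fun _ => p.1) -
          ContinuousMultilinearMap.compContinuousLinearMapContinuousMultilinear ℝ
            (fun _ : Fin i => E) (fun _ => ℝ) ℂ (fun _ => q.1)‖
  let B : ((E →L[ℝ] ℝ) × ℝ) → ℝ := fun p => ∑ i ∈ Finset.range (m + 1),
    (m.choose i : ℝ) * (A p i * (SchwartzMap.seminorm ℝ k (m - i) φ +
        SchwartzMap.seminorm ℝ (k + 2) (m - i) φ))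
  have hAc : ∀ i, Continuous fun p => A p i := fun i => by
    -- The pullback operator is a continuous multilinear function of the maps it pulls back along,
    -- hence continuous in operator norm.
    have hK : Continuous fun p : (E →L[ℝ] ℝ) × ℝ =>
        ContinuousMultilinearMap.compContinuousLinearMapContinuousMultilinear ℝ
            (fun _ : Fin i => E) (fun _ => ℝ) ℂ (fun _ => p.1) :=
      (ContinuousMultilinearMap.cont _).comp (continuous_pi fun _ => continuous_fst)
    exact ((continuous_const.mul ((continuous_fst.sub continuous_const).norm.add
      (continuous_snd.sub continuous_const).abs)).mul (continuous_fst.norm.pow i)).add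
      (continuous_const.mul (hK.sub continuous_const).norm)
  have hBc : Continuous B := continuous_finsetSum _ fun i _ =>
    continuous_const.mul ((hAc i).mul continuous_const)
  have hBq : B q = 0 := by simp [B, A]
  have hev : ∀ᶠ p in nhds q, B p < ε := hBc.continuousAt.eventually_lt_const (by rwa [hBq])
  filter_upwards [hev] with p hp
  refine lt_of_le_of_lt ?_ hp
  rw [← sub_apply, ← smulLeftCLM_sub (hasTemperateGrowth_ridge g p) (hasTemperateGrowth_ridge g q)]
  exact seminorm_smulLeftCLM_le
    ((hasTemperateGrowth_ridge g p).sub (hasTemperateGrowth_ridge g q)) φ k m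
    (fun i => by positivity) (fun i x => norm_iteratedFDeriv_ridge_sub_le g p q i x)

/-- Uniform decay in the offset of the product of a Schwartz function with a ridge function. -/
theorem exists_seminorm_smulLeftCLM_ridge_le (g : 𝓢(ℝ, ℂ)) (φ : 𝓢(E, ℂ)) (k m : ℕ) :
    ∃ C : ℝ, ∀ p : (E →L[ℝ] ℝ) × ℝ, ‖p.1‖ ≤ 1 →
      SchwartzMap.seminorm ℝ k m (smulLeftCLM ℂ (ridge g p) φ) ≤ C * (1 + p.2 ^ 2)⁻¹ := by
  refine ⟨∑ i ∈ Finset.range (m + 1), (m.choose i : ℝ) *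
    (2 * (SchwartzMap.seminorm ℝ 0 i g + SchwartzMap.seminorm ℝ 2 i g) *
      (SchwartzMap.seminorm ℝ k (m - i) φ + SchwartzMap.seminorm ℝ (k + 2) (m - i) φ)),
    fun p hp => ?_⟩
  refine (seminorm_smulLeftCLM_le (hasTemperateGrowth_ridge g p) φ k m (fun i => by positivity)
    (fun i x => norm_iteratedFDeriv_ridge_le g hp i x)).trans_eq ?_
  rw [Finset.sum_mul]
  exact Finset.sum_congr rfl fun i _ => by ring

end Ridge

end SchwartzMap

/-! ### Reduction to ridge functions and conclusion -/

namespace DSTFRFT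

theorem isProbabilityMeasure_sphereMeasure {n : ℕ} (hn : n ≠ 0) :
    IsProbabilityMeasure (sphereMeasure n) := by
  -- The surface measure is zero only in dimension zero.
  have : NeZero ((volume : Measure (Rn n)).toSphere) :=
    ⟨by simpa [Measure.toSphere_eq_zero_iff_finrank] using hn⟩
  exact MeasureTheory.isProbabilityMeasureSMul

/-- The Schwartz function `t ↦ conj (ψ t) * η t`. -/
def conjMul (ψ η : 𝓢(ℝ, ℂ)) : 𝓢(ℝ, ℂ) := SchwartzMap.smulLeftCLM ℂ (fun t => conj (ψ t)) η

theorem conjMul_apply (ψ η : 𝓢(ℝ, ℂ)) (t : ℝ) : conjMul ψ η t = conj (ψ t) * η t :=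
  SchwartzMap.smulLeftCLM_apply_apply
    ((Complex.conjCLE : ℂ ≃L[ℝ] ℂ).hasTemperateGrowth.comp ψ.hasTemperateGrowth) η t

theorem integral_conjMul (ψ η : 𝓢(ℝ, ℂ)) : ∫ t, conjMul ψ η t = l2Inner η ψ :=
  integral_congr_ae (Filter.Eventually.of_forall fun t => by
    simp only [conjMul_apply, mul_comm])

/-- The inner conjugations cancel, leaving `conj ψ · η` at `u·x - b` times `φ`. -/
theorem windowedTest_conjTest_windowedTest {n : ℕ} (ψ η : 𝓢(ℝ, ℂ)) (φ : 𝓢(Rn n, ℂ)) (u : Sn n)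
    (b : ℝ) : windowedTest ψ u b (conjTest (windowedTest η u b (conjTest φ))) =
      SchwartzMap.smulLeftCLM ℂ ((conjMul ψ η).ridge (innerSL ℝ (u : Rn n), b)) φ := by
  ext x
  rw [SchwartzMap.smulLeftCLM_apply_apply (SchwartzMap.hasTemperateGrowth_ridge _ _), smul_eq_mul]
  change window ψ u b x * conj (window η u b x * conj (φ x)) =
    conjMul ψ η (inner ℝ (u : Rn n) x - b) * φ x
  rw [conjMul_apply, real_inner_comm]
  simp only [window, map_mul, Complex.conj_conj]
  ring

end DSTFRFT

end

theorem corollary6p2 (n : ℕ) (hn : 2 ≤ n) (α : Fin n → ℝ) (hα : DSTFRFT.IsOrder α)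
    (f : 𝓢'(DSTFRFT.Rn n, ℂ)) (ψ η : 𝓢(ℝ, ℂ)) (hψ : ψ ≠ 0) (hη : DSTFRFT.l2Inner η ψ ≠ 0)
    (φ : 𝓢(DSTFRFT.Rn n, ℂ)) :
    Integrable
      (fun p : DSTFRFT.Sn n × ℝ =>
        DSTFRFT.frftDistribution α hα (DSTFRFT.windowed ψ p.1 p.2 f)
          (DSTFRFT.dstfrftTest α hα η φ p.1 p.2))
      ((DSTFRFT.sphereMeasure n).prod volume) ∧
    f φ = (DSTFRFT.l2Inner η ψ)⁻¹ *
      ∫ u : DSTFRFT.Sn n, (∫ b : ℝ,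
        DSTFRFT.frftDistribution α hα (DSTFRFT.windowed ψ u b f)
          (DSTFRFT.dstfrftTest α hα η φ u b)) ∂(DSTFRFT.sphereMeasure n) := by
  have := DSTFRFT.isProbabilityMeasure_sphereMeasure (n := n) (by lia)
  simp only [DSTFRFT.frftDistribution_windowed_dstfrftTest,
    DSTFRFT.windowedTest_conjTest_windowedTest]
  set g := DSTFRFT.conjMul ψ η with hg
  let q : DSTFRFT.Sn n × ℝ → (DSTFRFT.Rn n →L[ℝ] ℝ) × ℝ := fun p =>
    (innerSL ℝ (p.1 : DSTFRFT.Rn n), p.2)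
  have hq : Continuous q :=
    ((innerSL ℝ).continuous.comp (continuous_subtype_val.comp continuous_fst)).prodMk continuous_snd
  have hq1 : ∀ p, ‖(q p).1‖ ≤ 1 := fun p => by simp [q]
  let Φ : DSTFRFT.Sn n × ℝ → 𝓢(DSTFRFT.Rn n, ℂ) := fun p =>
    SchwartzMap.smulLeftCLM ℂ (g.ridge (q p)) φ
  have hΦ : Continuous Φ := (SchwartzMap.continuous_smulLeftCLM_ridge g φ).comp hq
  have hΦx : ∀ p x, Φ p x = g (inner ℝ (p.1 : DSTFRFT.Rn n) x - p.2) * φ x := fun p x =>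
    SchwartzMap.smulLeftCLM_apply_apply (SchwartzMap.hasTemperateGrowth_ridge g (q p)) φ x
  have hk : ∀ k m, ∃ B : DSTFRFT.Sn n × ℝ → ℝ,
      Integrable B ((DSTFRFT.sphereMeasure n).prod volume) ∧
        ∀ p, SchwartzMap.seminorm ℝ k m (Φ p) ≤ B p := fun k m => by
    obtain ⟨C, hC⟩ := SchwartzMap.exists_seminorm_smulLeftCLM_ridge_le g φ k m
    exact ⟨fun p => C * (1 + p.2 ^ 2)⁻¹, (integrable_inv_one_add_sq.comp_snd _).const_mul C,
      fun p => hC (q p) (hq1 p)⟩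
  have hint : ∀ x, Integrable (fun p => Φ p x) ((DSTFRFT.sphereMeasure n).prod volume) :=
    fun x => by
      -- Evaluation at `x` of the derivative of order zero with weight zero.
      have := (BoundedContinuousFunction.evalCLM ℝ x).integrable_comp
        (SchwartzMap.integrable_weightedIteratedFDeriv ℝ hΦ (hk 0 0))
      have h2 := (continuousMultilinearCurryFin0 ℝ (DSTFRFT.Rn n) ℂ).toContinuousLinearEquiv
        |>.toContinuousLinearMap.integrable_comp this
      simpa [SchwartzMap.weightedIteratedFDeriv_apply] using h2
  have hχ : ∀ x, (DSTFRFT.l2Inner η ψ • φ) x =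
      ∫ p, Φ p x ∂((DSTFRFT.sphereMeasure n).prod volume) := fun x => by
    rw [integral_prod _ (hint x)]
    -- The integral over `b` does not depend on `u`, so averaging over the sphere leaves it
    -- unchanged.
    have h1 : ∀ u : DSTFRFT.Sn n, ∫ b, Φ (u, b) x = DSTFRFT.l2Inner η ψ * φ x := fun u => by
      simp only [hΦx]
      rw [integral_mul_const, integral_sub_left_eq_self (fun t => g t), hg,
        DSTFRFT.integral_conjMul]
    simp only [h1, integral_const, probReal_univ, one_smul]
    rfl
  obtain ⟨h1, h2⟩ := SchwartzMap.integrable_and_integral_apply ℂ f hΦ hk _ hχ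
  refine ⟨h1, ?_⟩
  rw [eq_inv_mul_iff_mul_eq₀ hη, ← smul_eq_mul, ← map_smul]
  exact h2.trans (integral_prod _ h1)
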